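/- All graphs are finite and simple. For a connected graph $G$ with $n$ vertices, all of positive even degree, let $\operatorname{EO}(G)$ be the number of Eulerian orientations of $G$ (orientations of the edges in which every vertex has equal in-degree and out-degree) and let $t(G)$ be the number of spanning trees of $G$. Define the residual entropy $\rho(G) := \frac1n \log \operatorname{EO}(G)$ and the spanning tree entropy $\tau(G) := \frac1n \log t(G)$. **Theorem.** There is no function $\mathring\rho(d,\tau)$ with the following property for every positive even integer $d$ and every real $\tau$: if $G_1, G_2, \ldots$ is a sequence of connected $d$-regular graphs whose numbers of vertices are strictly increasing, and $\tau(G_i) \to \tau$ as $i\to\infty$, then $\rho(G_i) \to \mathring\rho(d,\tau)$. (A fortiori, there is no such function when multiple edges are allowed.) -/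

import Mathlib

open Filter Topology

/-- `D` is an orientation of the simple graph `G`: every edge `{u, v}` of `G` is given exactly one
of its two directions, and `D` has no other arcs. -/
def IsOrientation {V : Type*} (G : SimpleGraph V) (D : Digraph V) : Prop :=
  (∀ u v, D.Adj u v → G.Adj u v) ∧
    ∀ u v, G.Adj u v → (D.Adj u v ↔ ¬ D.Adj v u)

/-- The in-degree of a vertex of a digraph. -/
noncomputable def inDeg {V : Type*} (D : Digraph V) (v : V) : ℕ :=
  {u : V | D.Adj u v}.ncard

/-- The out-degree of a vertex of a digraph. -/
noncomputable def outDeg {V : Type*} (D : Digraph V) (v : V) : ℕ :=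
  {u : V | D.Adj v u}.ncard

/-- The set of Eulerian orientations of `G`: the orientations in which every vertex has equal
in-degree and out-degree. -/
def eulerianOrientations {V : Type*} (G : SimpleGraph V) : Set (Digraph V) :=
  {D | IsOrientation G D ∧ ∀ v, inDeg D v = outDeg D v}

/-- The set of spanning trees of `G`, as simple graphs on the full vertex set of `G`. -/
def spanningTrees {V : Type*} (G : SimpleGraph V) : Set (SimpleGraph V) :=
  {T | T ≤ G ∧ T.IsTree}

/-- The residual entropy `ρ(G) = (1 / n) * log EO(G)` of a graph with `n` vertices. -/
noncomputable def residualEntropy {V : Type*} [Fintype V] (G : SimpleGraph V) : ℝ :=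
  1 / (Fintype.card V : ℝ) * Real.log ((eulerianOrientations G).ncard : ℝ)

/-- The spanning tree entropy `τ(G) = (1 / n) * log t(G)` of a graph with `n` vertices. -/
noncomputable def spanningTreeEntropy {V : Type*} [Fintype V] (G : SimpleGraph V) : ℝ :=
  1 / (Fintype.card V : ℝ) * Real.log ((spanningTrees G).ncard : ℝ)

/-- `G 0, G 1, …` is an increasing sequence of connected `d`-regular simple graphs: the `i`-th
graph has `n i` vertices and the orders `n i` are strictly increasing. -/
def IsIncreasingRegularSeq (d : ℕ) (n : ℕ → ℕ) (G : ∀ i, SimpleGraph (Fin (n i))) : Prop :=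
  StrictMono n ∧ ∀ i, (G i).Connected ∧ ∀ v, ((G i).neighborSet v).ncard = d

/-! Take a gadget `E` on ten vertices whose root has degree 2 and whose other vertices have degree
4, and attach a copy of it by its root to each vertex of a cycle of length `k + 3`. The result is a
connected 4-regular graph, and both counts factor: each is the count for the cycle times the `(k +
3)`-th power of the count for `E`. For trees this is the block structure at a cut vertex
(`ncard_spanningTrees_rootedProduct`). For Eulerian orientations, a copy balanced away from its root
is balanced at its root too, since in-degrees and out-degrees have the same sum; so cycle and copies
decouple (`ncard_eulerianOrientations_rootedProduct`).

Two gadgets with equally many spanning trees (15360) but 160 and 164 Eulerian orientations then give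
sequences with identical spanning tree entropies, while their residual entropies differ by the
nonzero constant `log (164 / 160) / 10`. The tree entropies are bounded, so some subsequence
converges, and along it the two residual entropies cannot share a limit
(`not_exists_limit_of_gadgets`).

The gadget counts are evaluated by the kernel, through verified recursions on edge lists:
deletion-contraction for trees (`ncard_isTree_between`), and branching on the direction of an edge
for orientations (`ncard_orientations_ofList`). -/

namespace SimpleGraph

/-! ### Rooted products of graphs: connectivity, spanning trees, degrees. -/

variable {ι V W : Type*}

/-- The graph obtained from disjoint graphs `F i` on `V`, one for each vertex `i` of the base graph
`B`, by joining their copies of the root `r` according to `B`. -/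
def rootedProduct (B : SimpleGraph ι) (r : V) (F : ι → SimpleGraph V) : SimpleGraph (ι × V) where
  Adj p q := (p.1 = q.1 ∧ (F p.1).Adj p.2 q.2) ∨ (B.Adj p.1 q.1 ∧ p.2 = r ∧ q.2 = r)
  symm := ⟨by
    rintro ⟨i, x⟩ ⟨j, y⟩ (⟨h, h'⟩ | ⟨h, h1, h2⟩)
    · dsimp at h h'; subst h; exact Or.inl ⟨rfl, h'.symm⟩
    · exact Or.inr ⟨h.symm, h2, h1⟩⟩
  loopless := ⟨by
    rintro ⟨i, x⟩ (⟨_, h⟩ | ⟨h, _⟩)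
    · exact h.ne rfl
    · exact h.ne rfl⟩

variable {B S S' : SimpleGraph ι} {r : V} {F F' : ι → SimpleGraph V}

theorem rootedProduct_adj {p q : ι × V} : (rootedProduct B r F).Adj p q ↔
    (p.1 = q.1 ∧ (F p.1).Adj p.2 q.2) ∨ (B.Adj p.1 q.1 ∧ p.2 = r ∧ q.2 = r) := Iff.rfl

theorem rootedProduct_adj_same {i : ι} {x y : V} :
    (rootedProduct B r F).Adj (i, x) (i, y) ↔ (F i).Adj x y := by
  simp [rootedProduct_adj]

theorem rootedProduct_adj_root {i j : ι} :
    (rootedProduct B r F).Adj (i, r) (j, r) ↔ B.Adj i j := by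
  simp [rootedProduct_adj]

theorem rootedProduct_le_iff :
    rootedProduct S r F ≤ rootedProduct S' r F' ↔ S ≤ S' ∧ ∀ i, F i ≤ F' i := by
  refine ⟨fun h => ⟨fun i j hij => ?_, fun i x y hxy => ?_⟩, fun h p q hpq => ?_⟩
  · exact rootedProduct_adj_root.1 (h (rootedProduct_adj_root.2 hij))
  · exact rootedProduct_adj_same.1 (h (rootedProduct_adj_same.2 hxy))
  · exact hpq.imp (fun ⟨a, b⟩ => ⟨a, h.2 _ b⟩) (fun ⟨a, b⟩ => ⟨h.1 a, b⟩)

theorem rootedProduct_injective (r : V) :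
    Function.Injective fun p : SimpleGraph ι × (ι → SimpleGraph V) => rootedProduct p.1 r p.2 := by
  rintro ⟨S, F⟩ ⟨S', F'⟩ h
  have h1 := rootedProduct_le_iff.1 (le_of_eq h)
  have h2 := rootedProduct_le_iff.1 (ge_of_eq h)
  exact Prod.ext (le_antisymm h1.1 h2.1) (funext fun i => le_antisymm (h1.2 i) (h2.2 i))

/-- Every edge lies in one fibre or joins two roots, so `T` is recovered from its restrictions to
the fibres and to the set of roots. -/
theorem exists_eq_rootedProduct_of_le {T : SimpleGraph (ι × V)} (h : T ≤ rootedProduct B r F) :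
    ∃ S' F', T = rootedProduct S' r F' := by
  refine ⟨T.comap fun i => (i, r), fun i => T.comap fun x => (i, x), ?_⟩
  ext ⟨i, x⟩ ⟨j, y⟩
  simp only [rootedProduct_adj, comap_adj]
  constructor
  · intro hT
    rcases h hT with ⟨h1, -⟩ | ⟨-, h2, h3⟩
    · dsimp at h1; subst h1; exact Or.inl ⟨rfl, hT⟩
    · dsimp at h2 h3; subst h2; subst h3; exact Or.inr ⟨hT, rfl, rfl⟩
  · rintro (⟨rfl, h1⟩ | ⟨h1, rfl, rfl⟩) <;> exact h1

/-- Weaker than asking for a homomorphism: edges may collapse, as they do under the projections of a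
rooted product to its base and fibres. -/
theorem Reachable.of_forall_adj {G : SimpleGraph V} {H : SimpleGraph W} (f : V → W)
    (hf : ∀ u v, G.Adj u v → H.Reachable (f u) (f v)) {u v : V} (h : G.Reachable u v) :
    H.Reachable (f u) (f v) := by
  obtain ⟨w⟩ := h
  induction w with
  | nil => exact Reachable.refl _
  | cons h _ ih => exact (hf _ _ h).trans ih

theorem connected_rootedProduct_iff [Nonempty ι] :
    (rootedProduct S r F).Connected ↔ S.Connected ∧ ∀ i, (F i).Connected := by
  classical
  constructor
  · intro h
    have : Nonempty V := ⟨r⟩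
    refine ⟨⟨fun i j => ?_⟩, fun i => ⟨fun x y => ?_⟩⟩
    · refine (h.preconnected (i, r) (j, r)).of_forall_adj Prod.fst ?_
      rintro p q (⟨h1, -⟩ | ⟨h1, -⟩)
      · rw [h1]
      · exact h1.reachable
    -- Retract the product onto the fibre over `i` by sending every other fibre to the root.
    · have := (h.preconnected (i, x) (i, y)).of_forall_adj (H := F i)
        (fun p => if p.1 = i then p.2 else r) ?_
      · simpa using this
      rintro ⟨j, x⟩ ⟨k, y⟩ (⟨h1, h2⟩ | ⟨-, h2, h3⟩)
      · dsimp at h1 h2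
        subst h1
        by_cases hj : j = i
        · subst hj; simpa using h2.reachable
        · simp [hj]
      · dsimp at h2 h3
        simp [h2, h3]
  · rintro ⟨hS, hF⟩
    have key : ∀ i x, (rootedProduct S r F).Reachable (i, x) (i, r) := fun i x =>
      ((hF i).preconnected x r).of_forall_adj (fun y => (i, y))
        fun u v h => (rootedProduct_adj_same.2 h).reachable
    have base : ∀ i j, (rootedProduct S r F).Reachable (i, r) (j, r) := fun i j =>
      (hS.preconnected i j).of_forall_adj (fun y => (y, r))
        fun u v h => (rootedProduct_adj_root.2 h).reachable
    have : Nonempty V := ⟨r⟩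
    exact ⟨fun p q => (key p.1 p.2).trans ((base p.1 q.1).trans (key q.1 q.2).symm)⟩

/-- Trees are the minimal connected graphs. Connectedness and the order are both componentwise in
the factors, hence so is minimality. -/
theorem isTree_rootedProduct_iff [Nonempty ι] :
    (rootedProduct S r F).IsTree ↔ S.IsTree ∧ ∀ i, (F i).IsTree := by
  classical
  simp only [isTree_iff_minimal_connected]
  constructor
  · rintro ⟨hc, hm⟩
    rw [connected_rootedProduct_iff] at hc
    refine ⟨⟨hc.1, fun S' hS' hle => ?_⟩, fun i => ⟨hc.2 i, fun H hH hle => ?_⟩⟩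
    · exact (rootedProduct_le_iff.1 (hm (connected_rootedProduct_iff.2 ⟨hS', hc.2⟩)
        (rootedProduct_le_iff.2 ⟨hle, fun _ => le_rfl⟩))).1
    · have := (rootedProduct_le_iff.1 (hm
        ((connected_rootedProduct_iff (F := Function.update F i H)).2 ⟨hc.1, fun j => ?_⟩)
        (rootedProduct_le_iff.2 ⟨le_rfl, fun j => ?_⟩))).2 i
      · simpa using this
      · by_cases h : j = i
        · subst h; simpa using hH
        · simpa [h] using hc.2 j
      · by_cases h : j = i
        · subst h; simpa using hle
        · simp [h]
  · rintro ⟨hS, hF⟩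
    refine ⟨connected_rootedProduct_iff.2 ⟨hS.1, fun i => (hF i).1⟩, fun T hT hle => ?_⟩
    obtain ⟨S', F', rfl⟩ := exists_eq_rootedProduct_of_le hle
    have hT := connected_rootedProduct_iff.1 hT
    have hle := rootedProduct_le_iff.1 hle
    exact rootedProduct_le_iff.2 ⟨hS.2 hT.1 hle.1, fun i => (hF i).2 (hT.2 i) (hle.2 i)⟩

theorem ncard_univ_pi {ι : Type*} [Fintype ι] {α : ι → Type*} (s : ∀ i, Set (α i)) :
    (Set.univ.pi s).ncard = ∏ i, (s i).ncard := by
  rw [← Nat.card_coe_set_eq, Nat.card_congr (Equiv.Set.univPi s), Nat.card_pi]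
  simp [Nat.card_coe_set_eq]

theorem ncard_spanningTrees_rootedProduct [Fintype ι] [Nonempty ι] :
    (spanningTrees (rootedProduct B r F)).ncard =
      (spanningTrees B).ncard * ∏ i, (spanningTrees (F i)).ncard := by
  have : spanningTrees (rootedProduct B r F) =
      (fun p : SimpleGraph ι × (ι → SimpleGraph V) => rootedProduct p.1 r p.2) ''
        (spanningTrees B ×ˢ Set.univ.pi fun i => spanningTrees (F i)) := by
    ext T
    constructor
    · rintro ⟨hle, hT⟩
      obtain ⟨S', F', rfl⟩ := exists_eq_rootedProduct_of_le hle
      have hT := isTree_rootedProduct_iff.1 hT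
      have hle := rootedProduct_le_iff.1 hle
      exact ⟨(S', F'), ⟨⟨hle.1, hT.1⟩, fun i _ => ⟨hle.2 i, hT.2 i⟩⟩, rfl⟩
    · rintro ⟨⟨S', F'⟩, ⟨h1, h2⟩, rfl⟩
      exact ⟨rootedProduct_le_iff.2 ⟨h1.1, fun i => (h2 i trivial).1⟩,
        isTree_rootedProduct_iff.2 ⟨h1.2, fun i => (h2 i trivial).2⟩⟩
  rw [this, Set.ncard_image_of_injective _ (rootedProduct_injective r), Set.ncard_prod,
    ncard_univ_pi]

/-- Neighbour, in-neighbour and out-neighbour sets in a rooted product all have this shape, so the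
three degree formulas reduce to it; `hs` makes the two parts disjoint. -/
theorem ncard_fiber_union [Finite ι] [Finite V] (r : V) {i : ι} (x : V) {s : Set ι} (hs : i ∉ s)
    (t : Set V) [Decidable (x = r)] :
    {p : ι × V | (p.1 = i ∧ p.2 ∈ t) ∨ (p.1 ∈ s ∧ p.2 = r ∧ x = r)}.ncard =
      t.ncard + if x = r then s.ncard else 0 := by
  have h1 : {p : ι × V | p.1 = i ∧ p.2 ∈ t} = (fun y => (i, y)) '' t := by
    ext ⟨a, b⟩; simp [eq_comm, and_comm]
  have h2 : {p : ι × V | p.1 ∈ s ∧ p.2 = r} = (fun y => (y, r)) '' s := by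
    ext ⟨a, b⟩; simp [eq_comm]
  have n1 : {p : ι × V | p.1 = i ∧ p.2 ∈ t}.ncard = t.ncard := by
    rw [h1, Set.ncard_image_of_injective _ (Prod.mk_right_injective i)]
  have n2 : {p : ι × V | p.1 ∈ s ∧ p.2 = r}.ncard = s.ncard := by
    rw [h2, Set.ncard_image_of_injective _ (Prod.mk_left_injective r)]
  split_ifs with hx
  · simp only [hx, and_true]
    rw [Set.ofPred_or, Set.ncard_union_eq, n1, n2]
    rw [Set.disjoint_left]
    rintro p ⟨rfl, -⟩ ⟨h, -⟩
    exact hs h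
  · simp [hx, n1]

theorem ncard_neighborSet_rootedProduct [Finite ι] [Finite V] (i : ι) (x : V)
    [Decidable (x = r)] :
    ((rootedProduct B r F).neighborSet (i, x)).ncard =
      ((F i).neighborSet x).ncard + if x = r then (B.neighborSet i).ncard else 0 := by
  rw [← ncard_fiber_union r x (i := i) (s := B.neighborSet i) (by simp) ((F i).neighborSet x)]
  congr 1
  ext ⟨j, y⟩
  simp only [mem_neighborSet, rootedProduct_adj, Set.mem_ofPred_eq]
  constructor
  · rintro (⟨rfl, h⟩ | ⟨h, h1, h2⟩)
    · exact Or.inl ⟨rfl, h⟩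
    · exact Or.inr ⟨h, h2, h1⟩
  · rintro (⟨rfl, h⟩ | ⟨h, h1, h2⟩)
    · exact Or.inl ⟨rfl, h⟩
    · exact Or.inr ⟨h, h2, h1⟩

end SimpleGraph

/-! ### Rooted products of digraphs and their Eulerian orientations. -/

namespace Digraph

variable {ι V : Type*}

/-- The analogue of `SimpleGraph.rootedProduct` for digraphs. -/
def rootedProduct (D : Digraph ι) (r : V) (F : ι → Digraph V) : Digraph (ι × V) where
  Adj p q := (p.1 = q.1 ∧ (F p.1).Adj p.2 q.2) ∨ (D.Adj p.1 q.1 ∧ p.2 = r ∧ q.2 = r)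

variable {D : Digraph ι} {r : V} {F : ι → Digraph V} {B : SimpleGraph ι} {E : ι → SimpleGraph V}

theorem rootedProduct_adj {p q : ι × V} : (rootedProduct D r F).Adj p q ↔
    (p.1 = q.1 ∧ (F p.1).Adj p.2 q.2) ∨ (D.Adj p.1 q.1 ∧ p.2 = r ∧ q.2 = r) := Iff.rfl

theorem rootedProduct_adj_same (hD : ∀ i, ¬ D.Adj i i) {i : ι} {x y : V} :
    (rootedProduct D r F).Adj (i, x) (i, y) ↔ (F i).Adj x y := by
  simp [rootedProduct_adj, hD]

theorem rootedProduct_adj_root (hF : ∀ i x, ¬ (F i).Adj x x) {i j : ι} :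
    (rootedProduct D r F).Adj (i, r) (j, r) ↔ D.Adj i j := by
  simp [rootedProduct_adj, hF]

theorem inDeg_rootedProduct [Finite ι] [Finite V] (hD : ∀ i, ¬ D.Adj i i) (i : ι) (x : V)
    [Decidable (x = r)] :
    inDeg (rootedProduct D r F) (i, x) = inDeg (F i) x + if x = r then inDeg D i else 0 := by
  unfold inDeg
  rw [← SimpleGraph.ncard_fiber_union r x (i := i) (s := {u | D.Adj u i}) (hD i)
    {u | (F i).Adj u x}]
  congr 1
  ext ⟨j, y⟩
  simp only [rootedProduct_adj, Set.mem_ofPred_eq]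
  refine or_congr_left (and_congr_right ?_)
  rintro rfl
  rfl

theorem outDeg_rootedProduct [Finite ι] [Finite V] (hD : ∀ i, ¬ D.Adj i i) (i : ι) (x : V)
    [Decidable (x = r)] :
    outDeg (rootedProduct D r F) (i, x) = outDeg (F i) x + if x = r then outDeg D i else 0 := by
  unfold outDeg
  rw [← SimpleGraph.ncard_fiber_union r x (i := i) (s := {u | D.Adj i u}) (hD i)
    {u | (F i).Adj x u}]
  congr 1
  ext ⟨j, y⟩
  simp only [rootedProduct_adj, Set.mem_ofPred_eq]
  constructor
  · rintro (⟨rfl, h⟩ | ⟨h, h1, h2⟩)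
    · exact Or.inl ⟨rfl, h⟩
    · exact Or.inr ⟨h, h2, h1⟩
  · rintro (⟨rfl, h⟩ | ⟨h, h1, h2⟩)
    · exact Or.inl ⟨rfl, h⟩
    · exact Or.inr ⟨h, h2, h1⟩

theorem sum_inDeg_eq_sum_outDeg [Fintype V] (D : Digraph V) :
    ∑ v, inDeg D v = ∑ v, outDeg D v := by
  classical
  have h1 : ∀ v, inDeg D v = ∑ u, if D.Adj u v then 1 else 0 := fun v => by
    simp [inDeg, Set.ncard_eq_toFinset_card']
  have h2 : ∀ v, outDeg D v = ∑ u, if D.Adj v u then 1 else 0 := fun v => by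
    simp [outDeg, Set.ncard_eq_toFinset_card']
  simp only [h1, h2]
  exact Finset.sum_comm

/-- In-degrees and out-degrees both sum to the number of arcs, so the last vertex has no freedom.
This is what decouples the gadgets from the base. -/
theorem inDeg_eq_outDeg_of_forall_ne [Fintype V] {D : Digraph V} {r : V}
    (h : ∀ v, v ≠ r → inDeg D v = outDeg D v) : inDeg D r = outDeg D r := by
  classical
  have := sum_inDeg_eq_sum_outDeg D
  rw [← Finset.add_sum_erase _ _ (Finset.mem_univ r),
    ← Finset.add_sum_erase _ (fun v => outDeg D v) (Finset.mem_univ r),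
    Finset.sum_congr rfl fun v hv => h v (Finset.ne_of_mem_erase hv)] at this
  exact Nat.add_right_cancel this

end Digraph

theorem IsOrientation.irrefl {V : Type*} {G : SimpleGraph V} {D : Digraph V}
    (h : IsOrientation G D) (v : V) : ¬ D.Adj v v :=
  fun hv => (h.1 v v hv).ne rfl

section

variable {ι V : Type*} {D : Digraph ι} {r : V} {F : ι → Digraph V} {B : SimpleGraph ι}
  {E : ι → SimpleGraph V}

theorem IsOrientation.rootedProduct (hD : IsOrientation B D) (hF : ∀ i, IsOrientation (E i) (F i)) :
    IsOrientation (B.rootedProduct r E) (D.rootedProduct r F) := by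
  refine ⟨fun p q => Or.imp (fun ⟨h1, h2⟩ => ⟨h1, (hF _).1 _ _ h2⟩)
    (fun ⟨h1, h2⟩ => ⟨hD.1 _ _ h1, h2⟩), ?_⟩
  rintro ⟨i, x⟩ ⟨j, y⟩ (⟨h1, h2⟩ | ⟨h1, h2, h3⟩)
  · dsimp at h1 h2
    subst h1
    rw [Digraph.rootedProduct_adj_same hD.irrefl, Digraph.rootedProduct_adj_same hD.irrefl]
    exact (hF i).2 _ _ h2
  · dsimp at h1 h2 h3
    subst h2; subst h3
    rw [Digraph.rootedProduct_adj_root fun i => (hF i).irrefl,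
      Digraph.rootedProduct_adj_root fun i => (hF i).irrefl]
    exact hD.2 _ _ h1

theorem IsOrientation.exists_eq_rootedProduct {D : Digraph (ι × V)}
    (h : IsOrientation (B.rootedProduct r E) D) :
    ∃ D' F', IsOrientation B D' ∧ (∀ i, IsOrientation (E i) (F' i)) ∧
      D = Digraph.rootedProduct D' r F' := by
  refine ⟨⟨fun i j => D.Adj (i, r) (j, r)⟩, fun i => ⟨fun x y => D.Adj (i, x) (i, y)⟩,
    ⟨fun i j hij => SimpleGraph.rootedProduct_adj_root.1 (h.1 _ _ hij),
      fun i j hij => h.2 _ _ (SimpleGraph.rootedProduct_adj_root.2 hij)⟩,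
    fun i => ⟨fun x y hxy => SimpleGraph.rootedProduct_adj_same.1 (h.1 _ _ hxy),
      fun x y hxy => h.2 _ _ (SimpleGraph.rootedProduct_adj_same.2 hxy)⟩, ?_⟩
  ext ⟨i, x⟩ ⟨j, y⟩
  simp only [Digraph.rootedProduct_adj]
  constructor
  · intro hT
    rcases h.1 _ _ hT with ⟨h1, -⟩ | ⟨-, h2, h3⟩
    · dsimp at h1; subst h1; exact Or.inl ⟨rfl, hT⟩
    · dsimp at h2 h3; subst h2; subst h3; exact Or.inr ⟨hT, rfl, rfl⟩
  · rintro (⟨rfl, h1⟩ | ⟨h1, rfl, rfl⟩) <;> exact h1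

theorem forall_inDeg_eq_outDeg_rootedProduct_iff [Fintype ι] [Fintype V]
    (hD : ∀ i, ¬ D.Adj i i) :
    (∀ p, inDeg (D.rootedProduct r F) p = outDeg (D.rootedProduct r F) p) ↔
      (∀ i, inDeg D i = outDeg D i) ∧ ∀ i x, inDeg (F i) x = outDeg (F i) x := by
  classical
  simp only [Prod.forall, Digraph.inDeg_rootedProduct hD, Digraph.outDeg_rootedProduct hD]
  constructor
  · intro h
    -- Away from the root, balance in the product is balance in the fibre; the root of the fibre
    -- follows, and cancelling its contribution leaves balance in the base.
    have hr : ∀ i, inDeg (F i) r = outDeg (F i) r := fun i =>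
      Digraph.inDeg_eq_outDeg_of_forall_ne fun v hv => by simpa [hv] using h i v
    refine ⟨fun i => ?_, fun i x => ?_⟩
    · simpa [hr i] using h i r
    · by_cases hx : x = r
      · rw [hx, hr i]
      · simpa [hx] using h i x
  · rintro ⟨h1, h2⟩ i x
    rw [h1, h2]

theorem ncard_eulerianOrientations_rootedProduct [Fintype ι] [Fintype V] :
    (eulerianOrientations (B.rootedProduct r E)).ncard =
      (eulerianOrientations B).ncard * ∏ i, (eulerianOrientations (E i)).ncard := by
  have : eulerianOrientations (B.rootedProduct r E) =
      (fun p : Digraph ι × (ι → Digraph V) => Digraph.rootedProduct p.1 r p.2) ''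
        (eulerianOrientations B ×ˢ Set.univ.pi fun i => eulerianOrientations (E i)) := by
    ext D
    constructor
    · rintro ⟨hD, hE⟩
      obtain ⟨D', F', h1, h2, rfl⟩ := hD.exists_eq_rootedProduct
      rw [forall_inDeg_eq_outDeg_rootedProduct_iff h1.irrefl] at hE
      exact ⟨(D', F'), ⟨⟨h1, hE.1⟩, fun i _ => ⟨h2 i, hE.2 i⟩⟩, rfl⟩
    · rintro ⟨⟨D', F'⟩, ⟨h1, h2⟩, rfl⟩
      exact ⟨h1.1.rootedProduct fun i => (h2 i trivial).1,
        (forall_inDeg_eq_outDeg_rootedProduct_iff h1.1.irrefl).2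
          ⟨h1.2, fun i => (h2 i trivial).2⟩⟩
  rw [this, Set.InjOn.ncard_image, Set.ncard_prod, SimpleGraph.ncard_univ_pi]
  -- A loop at `(i, r)` could come from either factor, so injectivity is available only for loopless
  -- digraphs, which orientations are.
  rintro ⟨D, F⟩ ⟨h1, h2⟩ ⟨D', F'⟩ ⟨h1', h2'⟩ h
  have hF : ∀ i, ∀ x, ¬ (F i).Adj x x := fun i => (h2 i trivial).1.irrefl
  have hF' : ∀ i, ∀ x, ¬ (F' i).Adj x x := fun i => (h2' i trivial).1.irrefl
  have hD : ∀ i, ¬ D.Adj i i := h1.1.irrefl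
  have hD' : ∀ i, ¬ D'.Adj i i := h1'.1.irrefl
  dsimp only at h
  refine Prod.ext ?_ (funext fun i => ?_)
  · ext i j
    dsimp only
    rw [← Digraph.rootedProduct_adj_root (r := r) (D := D) hF,
      ← Digraph.rootedProduct_adj_root (r := r) (D := D') hF', h]
  · ext x y
    dsimp only
    rw [← Digraph.rootedProduct_adj_same (r := r) (F := F) hD,
      ← Digraph.rootedProduct_adj_same (r := r) (F := F') hD', h]

end

/-! ### Counting spanning trees by deletion-contraction. -/

namespace SimpleGraph

/-- The simple graph whose edges are the pairs in a list. -/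
def ofList {V : Type*} : List (V × V) → SimpleGraph V
  | [] => ⊥
  | e :: M => edge e.1 e.2 ⊔ ofList M

/-- Distinct positions of the list hold distinct edges. -/
def NodupEdges {V : Type*} (M : List (V × V)) : Prop :=
  M.Pairwise fun p q => p ≠ q ∧ p ≠ (q.2, q.1)

theorem ofList_adj {V : Type*} {M : List (V × V)} {u v : V} :
    (ofList M).Adj u v ↔ u ≠ v ∧ ((u, v) ∈ M ∨ (v, u) ∈ M) := by
  induction M with
  | nil => simp [ofList]
  | cons e M ih =>
    obtain ⟨a, b⟩ := e
    simp only [ofList, sup_adj, edge_adj, ih, List.mem_cons, Prod.mk.injEq]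
    grind

instance {V : Type*} [DecidableEq V] (M : List (V × V)) : DecidableRel (ofList M).Adj :=
  fun _ _ => decidable_of_iff _ ofList_adj.symm

theorem not_ofList_adj_of_nodupEdges {V : Type*} {M : List (V × V)} {e : V × V}
    (h : NodupEdges (e :: M)) : ¬ (ofList M).Adj e.1 e.2 := by
  have := fun q => List.rel_of_pairwise_cons (a' := q) h
  rw [ofList_adj]
  rintro ⟨-, h | h⟩
  · exact (this _ h).1 rfl
  · exact (this _ h).2 rfl

/-- Replace the end `a` by `b` in each pair of a list, dropping the pairs that become loops. -/
def contractList (a b : ℕ) : List (ℕ × ℕ) → List (ℕ × ℕ)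
  | [] => []
  | e :: L =>
    bif Nat.beq e.1 a then
      (bif Nat.beq e.2 b then contractList a b L else (b, e.2) :: contractList a b L)
    else bif Nat.beq e.2 a then
      (bif Nat.beq e.1 b then contractList a b L else (e.1, b) :: contractList a b L)
    else e :: contractList a b L

/-- Deletion-contraction count of the spanning trees of a loopless multigraph with `k + 1` vertices
and edge list `L`; the first argument bounds the recursion. -/
def treeCount : ℕ → ℕ → List (ℕ × ℕ) → ℕ
  | _, 0, _ => 1
  | 0, _ + 1, _ => 0
  | _ + 1, _ + 1, [] => 0
  | f + 1, k + 1, e :: L => treeCount f (k + 1) L + treeCount f k (contractList e.1 e.2 L)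

/-- A faster version of `treeCount`. -/
def fastTreeCount : ℕ → ℕ → List (ℕ × ℕ) → ℕ
  | _, 0, _ => 1
  | _, 1, L => L.length
  | 0, _ + 2, _ => 0
  | _ + 1, _ + 2, [] => 0
  | f + 1, k + 2, e :: L => (bif Nat.ble (k + 2) L.length then fastTreeCount f (k + 2) L else 0) +
      fastTreeCount f (k + 1) (contractList e.1 e.2 L)

theorem length_contractList_le (a b : ℕ) (L : List (ℕ × ℕ)) :
    (contractList a b L).length ≤ L.length := by
  induction L with
  | nil => simp [contractList]
  | cons e L ih =>
    simp only [contractList, Bool.cond_eq_ite]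
    split_ifs <;> simp <;> omega

theorem treeCount_one {f : ℕ} {L : List (ℕ × ℕ)} (h : L.length ≤ f) :
    treeCount f 1 L = L.length := by
  induction f generalizing L with
  | zero =>
    obtain rfl : L = [] := List.length_eq_zero_iff.1 (by omega)
    rfl
  | succ f ih =>
    cases L with
    | nil => rfl
    | cons e L => simp [treeCount, ih (L := L) (by simpa using h)]

/-- A tree on `k + 1` vertices needs `k` edges; this justifies the pruning in `fastTreeCount`. -/
theorem treeCount_eq_zero {f k : ℕ} {L : List (ℕ × ℕ)} (h : L.length < k) :
    treeCount f k L = 0 := by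
  induction f generalizing L k with
  | zero => cases k with
    | zero => omega
    | succ k => rfl
  | succ f ih =>
    cases k with
    | zero => omega
    | succ k =>
      cases L with
      | nil => rfl
      | cons e L =>
        simp only [List.length_cons] at h
        have := length_contractList_le e.1 e.2 L
        simp [treeCount, ih (L := L) (k := k + 1) (by omega), ih (k := k) (this.trans_lt (by omega))]

theorem fastTreeCount_eq {f k : ℕ} {L : List (ℕ × ℕ)} (h : L.length ≤ f) :
    fastTreeCount f k L = treeCount f k L := by
  induction f generalizing L k with
  | zero =>
    obtain rfl : L = [] := List.length_eq_zero_iff.1 (by omega)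
    match k with
    | 0 => rfl
    | 1 => rfl
    | k + 2 => rfl
  | succ f ih =>
    match k, L with
    | 0, _ => rfl
    | 1, L => exact (treeCount_one h).symm
    | k + 2, [] => rfl
    | k + 2, e :: L =>
      have hL : L.length ≤ f := by simpa using h
      simp only [fastTreeCount, treeCount, Bool.cond_eq_ite, Nat.ble_eq]
      rw [ih ((length_contractList_le _ _ _).trans hL), ih hL]
      split_ifs with hk
      · rfl
      · rw [treeCount_eq_zero (k := k + 1 + 1) (by omega)]

/-- The loopless multigraph induced on the values of `c` by the pairs in a list. -/
def mapList {V : Type*} (c : V → ℕ) (M : List (V × V)) : List (ℕ × ℕ) :=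
  (M.map fun p => (c p.1, c p.2)).filter fun p => p.1 ≠ p.2

theorem mapList_cons_of_eq {V : Type*} {c : V → ℕ} {e : V × V} (M : List (V × V))
    (h : c e.1 = c e.2) : mapList c (e :: M) = mapList c M := by
  simp [mapList, h]

theorem mapList_cons_of_ne {V : Type*} {c : V → ℕ} {e : V × V} (M : List (V × V))
    (h : c e.1 ≠ c e.2) : mapList c (e :: M) = (c e.1, c e.2) :: mapList c M := by
  simp [mapList, h]

/-- Contraction only relabels: class `a` is merged into class `b`, and the edges that become loops
are those whose end labels now agree. -/
theorem contractList_mapList {V : Type*} (c : V → ℕ) (a b : ℕ) (M : List (V × V)) :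
    contractList a b (mapList c M) = mapList (fun x => if c x = a then b else c x) M := by
  induction M with
  | nil => rfl
  | cons e M ih =>
    by_cases h : c e.1 = c e.2
    · rw [mapList_cons_of_eq _ h, ih, mapList_cons_of_eq _ (by simp [h])]
    · rw [mapList_cons_of_ne _ h]
      simp only [contractList, ih, Bool.cond_eq_ite, Nat.beq_eq]
      by_cases h' : (if c e.1 = a then b else c e.1) = (if c e.2 = a then b else c e.2)
      · rw [mapList_cons_of_eq _ h']
        grind
      · rw [mapList_cons_of_ne _ h']
        grind

variable {V : Type*} {A : SimpleGraph V} {c : V → ℕ}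

theorem reachable_sup_edge_iff {u v : V} (hA : ∀ x y, A.Reachable x y ↔ c x = c y) (x y : V) :
    (A ⊔ edge u v).Reachable x y ↔
      (if c x = c u then c v else c x) = (if c y = c u then c v else c y) := by
  constructor
  · rintro ⟨w⟩
    induction w with
    | nil => rfl
    | cons h _ ih =>
      rw [← ih]
      rcases h with h | h
      · rw [(hA _ _).1 h.reachable]
      · rw [edge_adj] at h
        rcases h.1 with ⟨rfl, rfl⟩ | ⟨rfl, rfl⟩ <;> simp
  · have mono : ∀ {x y}, c x = c y → (A ⊔ edge u v).Reachable x y := fun h =>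
      ((hA _ _).2 h).mono le_sup_left
    have huv : (A ⊔ edge u v).Reachable u v := by
      by_cases h : u = v
      · rw [h]
      · exact Adj.reachable (Or.inr (by simp [edge_adj, h]))
    intro h
    split_ifs at h with h1 h2 h2
    · exact mono (h1.trans h2.symm)
    · exact (mono h1).trans (huv.trans (mono h))
    · exact (mono h).trans (huv.symm.trans (mono h2.symm))
    · exact mono h

theorem card_image_contract [Fintype V] [DecidableEq V] {u v : V} {k : ℕ} (huv : c u ≠ c v)
    (hk : (Finset.univ.image c).card = k + 1) :
    (Finset.univ.image fun x => if c x = c u then c v else c x).card = k := by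
  have : (Finset.univ.image fun x => if c x = c u then c v else c x) =
      (Finset.univ.image c).erase (c u) := by
    ext a
    simp only [Finset.mem_image, Finset.mem_univ, true_and, Finset.mem_erase]
    constructor
    · rintro ⟨x, rfl⟩
      split_ifs with h
      · exact ⟨huv.symm, v, rfl⟩
      · exact ⟨h, x, rfl⟩
    · rintro ⟨h, x, rfl⟩
      exact ⟨x, if_neg h⟩
  rw [this, Finset.card_erase_of_mem (by simp), hk]
  rfl

theorem edge_le_iff_adj {T : SimpleGraph V} {u v : V} (h : u ≠ v) : edge u v ≤ T ↔ T.Adj u v := by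
  refine ⟨fun hT => hT (by simp [edge_adj, h]), fun hT x y hxy => ?_⟩
  rw [edge_adj] at hxy
  rcases hxy.1 with ⟨rfl, rfl⟩ | ⟨rfl, rfl⟩
  exacts [hT, hT.symm]

theorem le_of_le_sup_edge {T H : SimpleGraph V} {u v : V} (h : T ≤ edge u v ⊔ H)
    (hT : ¬ T.Adj u v) : T ≤ H := by
  intro x y hxy
  rcases h hxy with h | h
  · rw [edge_adj] at h
    rcases h.1 with ⟨rfl, rfl⟩ | ⟨rfl, rfl⟩
    exacts [absurd hxy hT, absurd hxy.symm hT]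
  · exact h

/-- Here `A` is the forest of edges already chosen, `c` labels its `k + 1` components, and `M` lists
the undecided edges. Contracting the components of `A` turns the count into one of spanning trees of
a multigraph. Induct on `M`: an edge inside a component is a discarded loop; any other edge is
deleted, or added to `A` with its components merged. -/
theorem ncard_isTree_between [Fintype V] [DecidableEq V] (M : List (V × V)) (hM : NodupEdges M)
    (hA : A.IsAcyclic) (hc : ∀ x y, A.Reachable x y ↔ c x = c y) {k f : ℕ}
    (hk : (Finset.univ.image c).card = k + 1) (hf : (mapList c M).length ≤ f) :
    {T : SimpleGraph V | A ≤ T ∧ T ≤ A ⊔ ofList M ∧ T.IsTree}.ncard =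
      treeCount f k (mapList c M) := by
  induction M generalizing A c k f with
  | nil =>
    have key : {T : SimpleGraph V | A ≤ T ∧ T ≤ A ⊔ ofList [] ∧ T.IsTree} =
        {T | T = A ∧ k = 0} := by
      ext T
      simp only [ofList, sup_bot_eq, Set.mem_ofPred_eq]
      constructor
      · rintro ⟨h1, h2, hT⟩
        obtain rfl := le_antisymm h1 h2
        refine ⟨rfl, ?_⟩
        have : (Finset.univ.image c).card ≤ 1 := Finset.card_le_one.2 (by
          simp only [Finset.mem_image, Finset.mem_univ, true_and]
          rintro _ ⟨x, rfl⟩ _ ⟨y, rfl⟩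
          exact (hc x y).1 (hT.1.preconnected x y))
        omega
      · rintro ⟨rfl, rfl⟩
        have hne : (Finset.univ.image c).Nonempty := Finset.card_pos.1 (by omega)
        have : Nonempty V := by
          obtain ⟨a, ha⟩ := hne
          obtain ⟨x, -, -⟩ := Finset.mem_image.1 ha
          exact ⟨x⟩
        exact ⟨le_rfl, le_rfl, ⟨fun x y => (hc x y).2 (Finset.card_le_one.1 hk.le _ (by simp)
          _ (by simp))⟩, hA⟩
    rw [key]
    cases k with
    | zero => simp [treeCount]
    | succ k => cases f <;> simp [treeCount, mapList]
  | cons e M ih =>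
    obtain ⟨u, v⟩ := e
    have hM' : NodupEdges M := List.Pairwise.of_cons hM
    have hnM : ¬ (ofList M).Adj u v := not_ofList_adj_of_nodupEdges hM
    by_cases he : c u = c v
    · rw [mapList_cons_of_eq _ he] at hf ⊢
      rw [← ih hM' hA hc hk hf]
      congr 1
      ext T
      simp only [Set.mem_ofPred_eq, ofList]
      refine and_congr_right fun hAT => and_congr_left fun hT => ⟨fun h => ?_, fun h =>
        h.trans (sup_le_sup_left le_sup_right _)⟩
      by_cases huv : T.Adj u v
      -- The ends are already joined in `A`, so an edge `uv` of the acyclic graph `T` must be an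
      -- edge of `A` itself.
      · have := (isAcyclic_sup_fromEdgeSet_iff (G := A) (u := u) (v := v)).1
          (hT.2.anti (sup_le hAT ((edge_le_iff_adj huv.ne).2 huv)))
        have hAuv := (this.2 ((hc u v).2 he)).resolve_left huv.ne
        refine h.trans (sup_le le_sup_left (sup_le ?_ le_sup_right))
        exact ((edge_le_iff_adj huv.ne).2 hAuv).trans le_sup_left
      · exact le_of_le_sup_edge (by rwa [sup_left_comm] at h) huv
    · rw [mapList_cons_of_ne _ he] at hf ⊢
      have huv : u ≠ v := fun h => he (by rw [h])
      have hAuv : ¬ A.Reachable u v := fun h => he ((hc u v).1 h)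
      have hnA : ¬ A.Adj u v := fun h => hAuv h.reachable
      cases k with
      | zero =>
        exact absurd (Finset.card_le_one.1 hk.le _ (by simp) _ (by simp)) he
      | succ k =>
      cases f with
      | zero => simp at hf
      | succ f =>
      have hf' : (mapList c M).length ≤ f := by simpa using hf
      have hcon := contractList_mapList c (c u) (c v) M
      have h2 := ih hM' (hA.sup_edge_of_not_reachable hAuv) (reachable_sup_edge_iff hc)
        (card_image_contract he hk) (f := f)
        (hcon ▸ (length_contractList_le _ _ _).trans hf')
      simp only [treeCount]
      -- Split the trees into those avoiding `uv` and those containing it.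
      rw [hcon, ← ih hM' hA hc hk hf', ← h2, ← Set.ncard_union_eq]
      · congr 1
        ext T
        simp only [Set.mem_ofPred_eq, ofList, Set.mem_union]
        by_cases hT : T.Adj u v
        · have : ¬ T ≤ A ⊔ ofList M := fun h => by
            rcases h hT with h | h
            exacts [hnA h, hnM h]
          simp [this, sup_assoc, edge_le_iff_adj huv, hT]
        · have : ¬ edge u v ≤ T := fun h => hT ((edge_le_iff_adj huv).1 h)
          simp only [sup_le_iff, this, and_false, false_and, or_false]
          refine and_congr_right fun _ => and_congr_left fun _ => ⟨fun h => ?_, fun h =>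
            h.trans (sup_le_sup_left le_sup_right _)⟩
          exact le_of_le_sup_edge (by rwa [sup_left_comm] at h) hT
      · rw [Set.disjoint_left]
        rintro T ⟨-, h, -⟩ ⟨h', -, -⟩
        rcases h (((edge_le_iff_adj huv).1 (le_sup_right.trans h'))) with h | h
        exacts [hnA h, hnM h]

theorem ncard_spanningTrees_ofList {n : ℕ} (M : List (Fin (n + 1) × Fin (n + 1)))
    (hM : NodupEdges M) :
    (spanningTrees (ofList M)).ncard =
      fastTreeCount (mapList Fin.val M).length n (mapList Fin.val M) := by
  rw [fastTreeCount_eq le_rfl, ← ncard_isTree_between (A := ⊥) M hM isAcyclic_bot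
    (fun x y => by rw [reachable_bot, Fin.val_inj]) _ le_rfl]
  · simp [spanningTrees]
  · rw [Finset.card_image_of_injective _ Fin.val_injective, Finset.card_univ, Fintype.card_fin]

end SimpleGraph

/-! ### Counting orientations with prescribed out-degrees. -/

namespace Digraph

variable {V : Type*}

instance [Finite V] : Finite (Digraph V) :=
  Finite.of_injective Digraph.Adj fun _ _ h => Digraph.ext h

/-- Add the arc from `u` to `v`. -/
def addArc (u v : V) (D : Digraph V) : Digraph V where
  Adj x y := D.Adj x y ∨ (x = u ∧ y = v)

theorem outDeg_addArc [Finite V] [DecidableEq V] {D : Digraph V} {u v : V} (h : ¬ D.Adj u v)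
    (x : V) : outDeg (D.addArc u v) x = outDeg D x + if x = u then 1 else 0 := by
  unfold outDeg addArc
  split_ifs with hx
  · subst hx
    rw [← Set.ncard_insert_of_notMem (s := {y | D.Adj x y}) h]
    congr 1
    ext y
    simp [or_comm]
  · simp [hx]

end Digraph

section

variable {V : Type*} {G : SimpleGraph V} {D : Digraph V}

theorem IsOrientation.inDeg_add_outDeg [Finite V] (h : IsOrientation G D) (v : V) :
    inDeg D v + outDeg D v = (G.neighborSet v).ncard := by
  unfold inDeg outDeg
  rw [← Set.ncard_union_eq]
  · congr 1
    ext u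
    simp only [Set.mem_union, Set.mem_ofPred_eq, SimpleGraph.mem_neighborSet]
    refine ⟨fun h' => h'.elim (fun h' => (h.1 _ _ h').symm) (h.1 _ _), fun hG => ?_⟩
    have := h.2 _ _ hG
    tauto
  · rw [Set.disjoint_left]
    intro u h1 h2
    exact (h.2 _ _ (h.1 _ _ h1)).1 h1 h2

/-- In-degree plus out-degree is the degree, so balance means that the out-degree is half of it. -/
theorem eulerianOrientations_eq [Finite V] {h : V → ℕ}
    (hG : ∀ v, (G.neighborSet v).ncard = 2 * h v) :
    eulerianOrientations G = {D | IsOrientation G D ∧ ∀ v, outDeg D v = h v} := by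
  ext D
  refine and_congr_right fun hD => forall_congr' fun v => ?_
  have := hD.inDeg_add_outDeg v
  have := hG v
  omega

theorem IsOrientation.addArc {u v : V} (h : IsOrientation G D) (huv : u ≠ v)
    (hG : ¬ G.Adj u v) : IsOrientation (SimpleGraph.edge u v ⊔ G) (D.addArc u v) := by
  have h1 : ¬ D.Adj u v := fun h' => hG (h.1 _ _ h')
  have h2 : ¬ D.Adj v u := fun h' => hG (h.1 _ _ h').symm
  constructor
  · rintro x y (hD | ⟨rfl, rfl⟩)
    · exact Or.inr (h.1 _ _ hD)
    · exact Or.inl (by simp [SimpleGraph.edge_adj, huv])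
  · rintro x y (hxy | hxy)
    · rw [SimpleGraph.edge_adj] at hxy
      rcases hxy.1 with ⟨rfl, rfl⟩ | ⟨rfl, rfl⟩ <;> simp [Digraph.addArc, h1, h2, huv, huv.symm]
    · have h3 : ¬ (x = u ∧ y = v) := by rintro ⟨rfl, rfl⟩; exact hG hxy
      have h4 : ¬ (y = u ∧ x = v) := by rintro ⟨rfl, rfl⟩; exact hG hxy.symm
      simpa [Digraph.addArc, h3, h4] using h.2 _ _ hxy

theorem IsOrientation.exists_eq_addArc {u v : V}
    (h : IsOrientation (SimpleGraph.edge u v ⊔ G) D) (hG : ¬ G.Adj u v) (huv : D.Adj u v) :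
    ∃ D', IsOrientation G D' ∧ D = D'.addArc u v := by
  refine ⟨⟨fun x y => D.Adj x y ∧ G.Adj x y⟩, ⟨fun x y h => h.2, fun x y hxy => ?_⟩, ?_⟩
  · simpa [hxy, hxy.symm] using h.2 x y (Or.inr hxy)
  · ext x y
    simp only [Digraph.addArc]
    constructor
    · intro hD
      rcases h.1 _ _ hD with h' | h'
      · rw [SimpleGraph.edge_adj] at h'
        rcases h'.1 with ⟨rfl, rfl⟩ | ⟨rfl, rfl⟩
        · exact Or.inr ⟨rfl, rfl⟩
        · exact absurd huv ((h.2 _ _ (h.1 _ _ hD)).1 hD)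
      · exact Or.inl ⟨hD, h'⟩
    · rintro (h' | ⟨rfl, rfl⟩)
      exacts [h'.1, huv]

theorem injOn_addArc {u v : V} (hG : ¬ G.Adj u v) :
    Set.InjOn (Digraph.addArc u v) {D | IsOrientation G D} := by
  intro D hD D' hD' h
  have h1 : ¬ D.Adj u v := fun h' => hG (hD.1 _ _ h')
  have h2 : ¬ D'.Adj u v := fun h' => hG (hD'.1 _ _ h')
  ext x y
  have := congrFun (congrFun (congrArg Digraph.Adj h) x) y
  simp only [Digraph.addArc, eq_iff_iff] at this
  by_cases hxy : x = u ∧ y = v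
  · obtain ⟨rfl, rfl⟩ := hxy
    simp [h1, h2]
  · simpa [hxy] using this

/-- Exactly one direction of the new edge is used, and removing that arc lowers only the out-degree
of its tail. The additive form avoids truncated subtraction. -/
theorem ncard_orientations_sup_edge [Finite V] [DecidableEq V] {u v : V} (huv : u ≠ v)
    (hG : ¬ G.Adj u v) (h : V → ℕ) :
    {D | IsOrientation (SimpleGraph.edge u v ⊔ G) D ∧ ∀ x, outDeg D x = h x}.ncard =
      {D | IsOrientation G D ∧ ∀ x, outDeg D x + (if x = u then 1 else 0) = h x}.ncard +
      {D | IsOrientation G D ∧ ∀ x, outDeg D x + (if x = v then 1 else 0) = h x}.ncard := by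
  have hG' : ¬ G.Adj v u := fun h => hG h.symm
  have comm : SimpleGraph.edge v u = SimpleGraph.edge u v := SimpleGraph.edge_comm _ _
  have n1 : ∀ {D}, IsOrientation G D → ¬ D.Adj u v := fun hD h' => hG (hD.1 _ _ h')
  have n2 : ∀ {D}, IsOrientation G D → ¬ D.Adj v u := fun hD h' => hG' (hD.1 _ _ h')
  have inj : Set.InjOn (Digraph.addArc u v)
      {D | IsOrientation G D ∧ ∀ x, outDeg D x + (if x = u then 1 else 0) = h x} :=
    (injOn_addArc hG).mono fun D hD => hD.1
  have inj' : Set.InjOn (Digraph.addArc v u)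
      {D | IsOrientation G D ∧ ∀ x, outDeg D x + (if x = v then 1 else 0) = h x} :=
    (injOn_addArc hG').mono fun D hD => hD.1
  rw [← inj.ncard_image, ← inj'.ncard_image, ← Set.ncard_union_eq]
  · congr 1
    ext D
    constructor
    · rintro ⟨hD, hh⟩
      by_cases hD' : D.Adj u v
      · obtain ⟨D', h1, rfl⟩ := hD.exists_eq_addArc hG hD'
        exact Or.inl ⟨D', ⟨h1, fun x => by rw [← hh, Digraph.outDeg_addArc (n1 h1)]⟩, rfl⟩
      · have hvu : D.Adj v u := (hD.2 v u (Or.inl (by simp [SimpleGraph.edge_adj, huv.symm]))).2 hD'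
        obtain ⟨D', h1, rfl⟩ := (comm ▸ hD).exists_eq_addArc hG' hvu
        exact Or.inr ⟨D', ⟨h1, fun x => by rw [← hh, Digraph.outDeg_addArc (n2 h1)]⟩, rfl⟩
    · rintro (⟨D', ⟨h1, h2⟩, rfl⟩ | ⟨D', ⟨h1, h2⟩, rfl⟩)
      · exact ⟨h1.addArc huv hG, fun x => by rw [← h2, Digraph.outDeg_addArc (n1 h1)]⟩
      · exact ⟨comm ▸ h1.addArc huv.symm hG',
          fun x => by rw [← h2, Digraph.outDeg_addArc (n2 h1)]⟩
  · rw [Set.disjoint_left]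
    rintro _ ⟨D, ⟨h1, -⟩, rfl⟩ ⟨D', ⟨h2, -⟩, h3⟩
    have : (D'.addArc v u).Adj u v := h3 ▸ Or.inr ⟨rfl, rfl⟩
    simp [Digraph.addArc, n1 h2, huv] at this

end

namespace SimpleGraph

/-- Decrement an entry of a list. -/
def decrementAt : ℕ → List ℕ → List ℕ
  | _, [] => []
  | 0, a :: l => (a - 1) :: l
  | n + 1, a :: l => a :: decrementAt n l

/-- The number of orientations of the graph with edge list `L` and prescribed out-degrees `l`. -/
def orientationCount : List (ℕ × ℕ) → List ℕ → ℕ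
  | [], l => bif l.all (Nat.beq 0) then 1 else 0
  | e :: L, l =>
    (bif Nat.beq 0 (l.getD e.1 0) then 0 else orientationCount L (decrementAt e.1 l)) +
    (bif Nat.beq 0 (l.getD e.2 0) then 0 else orientationCount L (decrementAt e.2 l))

theorem length_decrementAt (n : ℕ) (l : List ℕ) : (decrementAt n l).length = l.length := by
  induction n, l using decrementAt.induct <;> simp_all [decrementAt]

theorem getD_decrementAt (n : ℕ) (l : List ℕ) (m : ℕ) :
    (decrementAt n l).getD m 0 = if m = n then l.getD m 0 - 1 else l.getD m 0 := by
  induction n, l using decrementAt.induct generalizing m with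
  | case1 => simp [decrementAt]
  | case2 a l => cases m <;> simp [decrementAt]
  | case3 n a l ih =>
    cases m with
    | zero => simp [decrementAt]
    | succ m => simpa [decrementAt] using ih m

theorem ncard_orientations_ofList {n : ℕ} (M : List (Fin n × Fin n)) (hM : NodupEdges M)
    (hloop : ∀ e ∈ M, e.1 ≠ e.2) (l : List ℕ) (hl : l.length = n) :
    {D | IsOrientation (ofList M) D ∧ ∀ x : Fin n, outDeg D x = l.getD x 0}.ncard =
      orientationCount (M.map fun e => (e.1.val, e.2.val)) l := by
  induction M generalizing l with
  | nil =>
    have key : {D | IsOrientation (ofList []) D ∧ ∀ x : Fin n, outDeg D x = l.getD x 0} =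
        {D : Digraph (Fin n) | D = ⟨fun _ _ => False⟩ ∧ ∀ a ∈ l, a = 0} := by
      have hz : (∀ x : Fin n, 0 = l.getD x 0) ↔ ∀ a ∈ l, a = 0 := by
        rw [List.forall_mem_iff_getElem]
        refine ⟨fun h i hi => ?_, fun h i => ?_⟩
        · simpa [hi] using (h ⟨i, hl ▸ hi⟩).symm
        · have hi : i.val < l.length := hl ▸ i.2
          simpa [hi] using (h i hi).symm
      ext D
      rw [Set.mem_ofPred_eq, Set.mem_ofPred_eq, ← hz]
      constructor
      · rintro ⟨hD, hh⟩
        obtain rfl : D = ⟨fun _ _ => False⟩ := by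
          ext x y
          exact iff_of_false (fun h => hD.1 _ _ h) id
        exact ⟨rfl, fun x => by rw [← hh]; simp [outDeg]⟩
      · rintro ⟨rfl, hh⟩
        exact ⟨⟨fun _ _ h => h.elim, fun _ _ h => h.elim⟩, fun x => by rw [← hh]; simp [outDeg]⟩
    rw [key]
    by_cases h : ∀ a ∈ l, a = 0
    · have : l.all (Nat.beq 0) = true := by
        rw [List.all_eq_true]; intro a ha; rw [h a ha]; rfl
      simp only [List.map_nil, orientationCount, this, cond_true]
      exact Set.ncard_eq_one.2 ⟨⟨fun _ _ => False⟩, by ext D; simpa using fun _ => h⟩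
    · have : l.all (Nat.beq 0) = false := by
        rw [← Bool.not_eq_true, List.all_eq_true]
        exact fun h' => h fun a ha => (Nat.eq_of_beq_eq_true (h' a ha)).symm
      simp only [List.map_nil, orientationCount, this, cond_false]
      simp [h]
  | cons e M ih =>
    obtain ⟨u, v⟩ := e
    have key : ∀ w : Fin n, {D | IsOrientation (ofList M) D ∧
        ∀ x : Fin n, outDeg D x + (if x = w then 1 else 0) = l.getD x 0}.ncard =
        bif Nat.beq 0 (l.getD w 0) then 0 else
          orientationCount (M.map fun e => (e.1.val, e.2.val)) (decrementAt w l) := by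
      intro w
      rw [← ih (List.Pairwise.of_cons hM) (fun e he => hloop e (List.mem_cons_of_mem _ he)) _
        ((length_decrementAt _ _).trans hl), Bool.cond_eq_ite]
      simp only [Nat.beq_eq]
      -- If `w` may have no outgoing arc, this branch is empty; the test also keeps `decrementAt`
      -- away from `0 - 1 = 0`.
      split_ifs with h0
      · rw [Set.ncard_eq_zero, Set.eq_empty_iff_forall_notMem]
        rintro D ⟨-, h⟩
        have := h w
        simp only [if_true] at this
        omega
      · congr 1
        ext D
        refine and_congr_right fun _ => forall_congr' fun x => ?_
        rw [getD_decrementAt]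
        by_cases hx : x = w
        · subst hx
          simp only [if_true]
          omega
        · simp [hx, Fin.val_inj]
    exact (ncard_orientations_sup_edge (hloop (u, v) (by simp))
      (not_ofList_adj_of_nodupEdges hM) _).trans (congrArg₂ _ (key u) (key v))

theorem ncard_eulerianOrientations_ofList {n : ℕ} (M : List (Fin n × Fin n)) (hM : NodupEdges M)
    (hloop : ∀ e ∈ M, e.1 ≠ e.2) (l : List ℕ) (hl : l.length = n)
    (hdeg : ∀ v : Fin n, ((ofList M).neighborSet v).ncard = 2 * l.getD v 0) :
    (eulerianOrientations (ofList M)).ncard =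
      orientationCount (M.map fun e => (e.1.val, e.2.val)) l := by
  rw [eulerianOrientations_eq hdeg, ncard_orientations_ofList M hM hloop l hl]

end SimpleGraph

/-! ### Transport of the counts along a bijection of vertices. -/

section

variable {V W : Type*}

theorem Equiv.ncard_preimage (e : W ≃ V) (s : Set V) : (e ⁻¹' s).ncard = s.ncard := by
  rw [← e.image_symm_eq_preimage, Set.ncard_image_of_injective _ e.symm.injective]

theorem ncard_neighborSet_comap (e : W ≃ V) (G : SimpleGraph V) (w : W) :
    ((G.comap e).neighborSet w).ncard = (G.neighborSet (e w)).ncard :=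
  e.ncard_preimage (G.neighborSet (e w))

theorem connected_comap (e : W ≃ V) {G : SimpleGraph V} (h : G.Connected) :
    (G.comap e).Connected :=
  (SimpleGraph.Iso.comap e G).connected_iff.2 h

theorem ncard_spanningTrees_comap (e : W ≃ V) (G : SimpleGraph V) :
    (spanningTrees (G.comap e)).ncard = (spanningTrees G).ncard := by
  have : spanningTrees (G.comap e) = SimpleGraph.comap e '' spanningTrees G := by
    ext T
    constructor
    · rintro ⟨h1, h2⟩
      refine ⟨T.comap e.symm, ⟨fun x y h => ?_, (SimpleGraph.Iso.comap e.symm T).isTree_iff.2 h2⟩,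
        ?_⟩
      · simpa using h1 h
      · ext x y; simp
    · rintro ⟨T, ⟨h1, h2⟩, rfl⟩
      exact ⟨fun x y h => h1 h, (SimpleGraph.Iso.comap e T).isTree_iff.2 h2⟩
  rw [this, Set.ncard_image_of_injective]
  intro S T h
  ext x y
  have := congrArg (fun H => H.Adj (e.symm x) (e.symm y)) h
  simpa using this

theorem ncard_eulerianOrientations_comap (e : W ≃ V) (G : SimpleGraph V) :
    (eulerianOrientations (G.comap e)).ncard = (eulerianOrientations G).ncard := by
  let f : Digraph V → Digraph W := fun D => ⟨fun x y => D.Adj (e x) (e y)⟩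
  have hin : ∀ D w, inDeg (f D) w = inDeg D (e w) := fun D w =>
    e.ncard_preimage {u | D.Adj u (e w)}
  have hout : ∀ D w, outDeg (f D) w = outDeg D (e w) := fun D w =>
    e.ncard_preimage {u | D.Adj (e w) u}
  have : eulerianOrientations (G.comap e) = f '' eulerianOrientations G := by
    ext D
    constructor
    · rintro ⟨⟨h1, h2⟩, h3⟩
      have hD : f ⟨fun x y => D.Adj (e.symm x) (e.symm y)⟩ = D := by
        ext x y; simp [f]
      refine ⟨_, ⟨⟨fun x y h => ?_, fun x y h => ?_⟩, fun v => ?_⟩, hD⟩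
      · simpa using h1 _ _ h
      · exact h2 _ _ (by simpa using h)
      · rw [← e.apply_symm_apply v, ← hin, ← hout, hD, h3]
    · rintro ⟨D, ⟨⟨h1, h2⟩, h3⟩, rfl⟩
      exact ⟨⟨fun x y h => h1 _ _ h, fun x y h => h2 _ _ h⟩, fun w => by rw [hin, hout, h3]⟩
  rw [this, Set.ncard_image_of_injective]
  intro S T h
  ext x y
  have := congrArg (fun H => H.Adj (e.symm x) (e.symm y)) h
  simpa [f] using this

end

/-! ### Cycles with a gadget at each vertex, and their entropies. -/

namespace SimpleGraph

theorem ncard_neighborSet_cycleGraph {n : ℕ} (v : Fin (n + 3)) :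
    ((cycleGraph (n + 3)).neighborSet v).ncard = 2 := by
  rw [← coe_neighborFinset, Set.ncard_coe_finset, card_neighborFinset_eq_degree,
    cycleGraph_degree_three_le]

theorem eulerianOrientations_cycleGraph_nonempty (n : ℕ) :
    (eulerianOrientations (cycleGraph (n + 3))).Nonempty := by
  -- With at least three vertices `1 + 1 ≠ 0`, so directing every edge from `u` to `u + 1` is
  -- consistent.
  have key : ∀ u v : Fin (n + 3), u - v = 1 → v - u ≠ 1 := by
    intro u v h1 h2
    have h : (1 : Fin (n + 3)) + 1 = 0 := 
      calc (1 : Fin (n + 3)) + 1 = (u - v) + (v - u) := by rw [h1, h2]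
        _ = 0 := by rw [sub_add_sub_cancel, sub_self]
    have := congrArg Fin.val h
    simp [Fin.val_add, Nat.mod_eq_of_lt] at this
  refine ⟨⟨fun u v => v - u = 1⟩, ⟨fun u v h => ?_, fun u v h => ?_⟩, fun v => ?_⟩
  · exact cycleGraph_adj.2 (Or.inr h)
  · rcases cycleGraph_adj.1 h with h | h
    · exact iff_of_false (key u v h) (not_not.2 h)
    · exact iff_of_true h (key v u h)
  · have h1 : {u : Fin (n + 3) | v - u = 1} = {v - 1} := by
      ext u; simp [sub_eq_iff_eq_add, eq_sub_iff_add_eq, eq_comm, add_comm]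
    have h2 : {u : Fin (n + 3) | u - v = 1} = {v + 1} := by
      ext u; simp [sub_eq_iff_eq_add, add_comm]
    simp only [inDeg, outDeg, h1, h2, Set.ncard_singleton]

theorem ncard_edgeSet_cycleGraph (n : ℕ) : (cycleGraph (n + 3)).edgeSet.ncard = n + 3 := by
  have := (cycleGraph (n + 3)).sum_degrees_eq_twice_card_edges
  simp only [cycleGraph_degree_three_le, Finset.sum_const, Finset.card_univ, Fintype.card_fin,
    smul_eq_mul] at this
  rw [← coe_edgeFinset, Set.ncard_coe_finset]
  omega

theorem ncard_spanningTrees_le {V : Type*} [Finite V] (G : SimpleGraph V) :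
    (spanningTrees G).ncard ≤ 2 ^ G.edgeSet.ncard := by
  rw [← Set.ncard_powerset _ (Set.toFinite _), ← Set.ncard_image_of_injective _ edgeSet_injective]
  refine Set.ncard_le_ncard ?_ (Set.toFinite _)
  rintro _ ⟨T, hT, rfl⟩
  exact edgeSet_mono hT.1

/-- The cycle of length `k + 3` with a copy of `E`, rooted at `0`, attached at each vertex. -/
noncomputable def sunGraph {m : ℕ} (E : SimpleGraph (Fin (m + 1))) (k : ℕ) :
    SimpleGraph (Fin ((k + 3) * (m + 1))) :=
  (rootedProduct (cycleGraph (k + 3)) 0 fun _ => E).comap finProdFinEquiv.symm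

variable {m : ℕ} {E E' : SimpleGraph (Fin (m + 1))}

theorem ncard_spanningTrees_sunGraph (E : SimpleGraph (Fin (m + 1))) (k : ℕ) :
    (spanningTrees (sunGraph E k)).ncard =
      (spanningTrees (cycleGraph (k + 3))).ncard * (spanningTrees E).ncard ^ (k + 3) := by
  rw [sunGraph, ncard_spanningTrees_comap, ncard_spanningTrees_rootedProduct]
  simp

theorem ncard_eulerianOrientations_sunGraph (E : SimpleGraph (Fin (m + 1))) (k : ℕ) :
    (eulerianOrientations (sunGraph E k)).ncard =
      (eulerianOrientations (cycleGraph (k + 3))).ncard *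
        (eulerianOrientations E).ncard ^ (k + 3) := by
  rw [sunGraph, ncard_eulerianOrientations_comap, ncard_eulerianOrientations_rootedProduct]
  simp

theorem connected_sunGraph (hE : E.Connected) (k : ℕ) : (sunGraph E k).Connected :=
  connected_comap _ (connected_rootedProduct_iff.2 ⟨cycleGraph_connected, fun _ => hE⟩)

theorem ncard_neighborSet_sunGraph {d : ℕ}
    (hE : ∀ v, (E.neighborSet v).ncard + (if v = 0 then 2 else 0) = d) (k : ℕ)
    (v : Fin ((k + 3) * (m + 1))) : ((sunGraph E k).neighborSet v).ncard = d := by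
  rw [sunGraph, ncard_neighborSet_comap, ← hE (finProdFinEquiv.symm v).2]
  exact (ncard_neighborSet_rootedProduct _ _).trans (by rw [ncard_neighborSet_cycleGraph]; rfl)

theorem isIncreasingRegularSeq_sunGraph {d : ℕ} (hE : E.Connected)
    (hd : ∀ v, (E.neighborSet v).ncard + (if v = 0 then 2 else 0) = d) {φ : ℕ → ℕ}
    (hφ : StrictMono φ) :
    IsIncreasingRegularSeq d (fun i => (φ i + 3) * (m + 1)) fun i => sunGraph E (φ i) :=
  ⟨fun _ _ hij => Nat.mul_lt_mul_of_pos_right (Nat.add_lt_add_right (hφ hij) 3) m.succ_pos,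
    fun _ => ⟨connected_sunGraph hE _, ncard_neighborSet_sunGraph hd _⟩⟩

/-- Only boundedness in `k` matters: compactness will supply the limit. The `+ 1` keeps the
logarithm nonnegative even for a gadget without spanning trees. -/
theorem spanningTreeEntropy_sunGraph_mem (E : SimpleGraph (Fin (m + 1))) (k : ℕ) :
    spanningTreeEntropy (sunGraph E k) ∈
      Set.Icc 0 (Real.log (2 * ((spanningTrees E).ncard + 1))) := by
  set t := (spanningTrees E).ncard
  have hle : (spanningTrees (sunGraph E k)).ncard ≤ (2 * (t + 1)) ^ (k + 3) := by
    rw [ncard_spanningTrees_sunGraph, mul_pow]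
    refine Nat.mul_le_mul ?_ (Nat.pow_le_pow_left (Nat.le_succ t) _)
    simpa [ncard_edgeSet_cycleGraph] using ncard_spanningTrees_le (cycleGraph (k + 3))
  have hlog : Real.log (spanningTrees (sunGraph E k)).ncard ≤
      (k + 3) * Real.log (2 * (t + 1)) := by
    rcases Nat.eq_zero_or_pos (spanningTrees (sunGraph E k)).ncard with h | h
    · rw [h]
      simp only [Nat.cast_zero, Real.log_zero]
      exact mul_nonneg (by positivity) (Real.log_nonneg (by
        have : (0 : ℝ) ≤ t := t.cast_nonneg
        linarith))
    · have := Real.log_le_log (by exact_mod_cast h) (Nat.cast_le (α := ℝ).2 hle)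
      push_cast at this
      rw [Real.log_pow] at this
      exact_mod_cast this
  have hpos : (0 : ℝ) ≤ Real.log (2 * (t + 1)) := Real.log_nonneg (by
    have : (0 : ℝ) ≤ t := t.cast_nonneg
    linarith)
  rw [spanningTreeEntropy, Fintype.card_fin]
  refine ⟨mul_nonneg (by positivity) (Real.log_natCast_nonneg _), ?_⟩
  rw [one_div, inv_mul_le_iff₀ (by positivity)]
  refine hlog.trans (mul_le_mul_of_nonneg_right ?_ hpos)
  push_cast
  have : (0 : ℝ) ≤ m := m.cast_nonneg
  have : (0 : ℝ) ≤ k := k.cast_nonneg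
  nlinarith [mul_nonneg ‹(0 : ℝ) ≤ k› ‹(0 : ℝ) ≤ m›]

/-- The first summand does not depend on `E`, so it cancels when two gadgets are compared and the
orientations of the cycle need not be counted. -/
theorem residualEntropy_sunGraph (hE : (eulerianOrientations E).ncard ≠ 0) (k : ℕ) :
    residualEntropy (sunGraph E k) =
      1 / ((k + 3) * (m + 1)) * Real.log (eulerianOrientations (cycleGraph (k + 3))).ncard +
        Real.log (eulerianOrientations E).ncard / (m + 1) := by
  have h0 : (eulerianOrientations (cycleGraph (k + 3))).ncard ≠ 0 :=
    ((Set.ncard_pos (Set.toFinite _)).2 (eulerianOrientations_cycleGraph_nonempty k)).ne'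
  rw [residualEntropy, ncard_eulerianOrientations_sunGraph, Fintype.card_fin, Nat.cast_mul,
    Nat.cast_mul, Nat.cast_pow, Real.log_mul (by exact_mod_cast h0) (by exact_mod_cast pow_ne_zero _ hE),
    Real.log_pow]
  have h1 : (k + 3 : ℝ) ≠ 0 := by positivity
  have h2 : (m + 1 : ℝ) ≠ 0 := by positivity
  push_cast
  field_simp

/-- Two gadgets with equally many spanning trees, but different numbers of Eulerian orientations,
show that the residual entropy is not determined by the spanning tree entropy. -/
theorem not_exists_limit_of_gadgets {d : ℕ} (hd : 0 < d) (hd' : Even d)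
    (hE : E.Connected) (hE' : E'.Connected)
    (hdeg : ∀ v, (E.neighborSet v).ncard + (if v = 0 then 2 else 0) = d)
    (hdeg' : ∀ v, (E'.neighborSet v).ncard + (if v = 0 then 2 else 0) = d)
    (ht : (spanningTrees E).ncard = (spanningTrees E').ncard)
    (h0 : (eulerianOrientations E).ncard ≠ 0) (h0' : (eulerianOrientations E').ncard ≠ 0)
    (hne : (eulerianOrientations E).ncard ≠ (eulerianOrientations E').ncard) :
    ¬ ∃ rho : ℕ → ℝ → ℝ,
      ∀ (d : ℕ), 0 < d → Even d → ∀ (τ : ℝ) (n : ℕ → ℕ) (G : ∀ i, SimpleGraph (Fin (n i))),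
        IsIncreasingRegularSeq d n G →
        Tendsto (fun i => spanningTreeEntropy (G i)) atTop (𝓝 τ) →
        Tendsto (fun i => residualEntropy (G i)) atTop (𝓝 (rho d τ)) := by
  rintro ⟨rho, h⟩
  obtain ⟨τ, -, φ, hφ, hτ⟩ := isCompact_Icc.tendsto_subseq (spanningTreeEntropy_sunGraph_mem E)
  have heq : ∀ k, spanningTreeEntropy (sunGraph E' k) = spanningTreeEntropy (sunGraph E k) := by
    intro k
    rw [spanningTreeEntropy, spanningTreeEntropy, ncard_spanningTrees_sunGraph,
      ncard_spanningTrees_sunGraph, ht]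
  have l1 := h d hd hd' τ _ _ (isIncreasingRegularSeq_sunGraph hE hdeg hφ) hτ
  have l2 := h d hd hd' τ _ _ (isIncreasingRegularSeq_sunGraph hE' hdeg' hφ)
    (by simpa only [heq, Function.comp_def] using hτ)
  have l3 := l1.sub l2
  simp only [residualEntropy_sunGraph h0, residualEntropy_sunGraph h0', add_sub_add_left_eq_sub,
    sub_self] at l3
  -- The difference of the two residual entropies is constant in `k`, yet it tends to zero.
  have l4 := tendsto_nhds_unique tendsto_const_nhds l3
  rw [sub_eq_zero, div_left_inj' (by positivity)] at l4
  refine hne (Nat.cast_injective (R := ℝ) (Real.log_injOn_pos (Set.mem_Ioi.2 ?_)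
    (Set.mem_Ioi.2 ?_) l4))
  · exact Nat.cast_pos.2 (Nat.pos_of_ne_zero h0)
  · exact Nat.cast_pos.2 (Nat.pos_of_ne_zero h0')

end SimpleGraph

/-! ### The two gadgets and their counts. -/

namespace SimpleGraph

/-- The edges of a graph with one vertex of degree two, nine vertices of degree four, 15360 spanning
trees and 160 Eulerian orientations. -/
def gadgetEdges : List (Fin 10 × Fin 10) :=
  [(0, 3), (0, 7), (1, 3), (1, 4), (1, 7), (1, 8), (2, 3), (2, 5), (2, 7), (2, 9), (3, 8), (4, 5),
    (4, 6), (4, 9), (5, 6), (5, 9), (6, 8), (6, 9), (7, 8)]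

/-- The edges of a graph with one vertex of degree two, nine vertices of degree four, 15360 spanning
trees and 164 Eulerian orientations. -/
def gadgetEdges' : List (Fin 10 × Fin 10) :=
  [(0, 5), (0, 8), (1, 2), (1, 3), (1, 6), (1, 7), (2, 5), (2, 6), (2, 8), (3, 4), (3, 6), (3, 9),
    (4, 7), (4, 8), (4, 9), (5, 8), (5, 9), (6, 7), (7, 9)]

instance {V : Type*} [DecidableEq V] (M : List (V × V)) : Decidable (NodupEdges M) :=
  inferInstanceAs (Decidable (List.Pairwise _ _))

theorem nodupEdges_gadgetEdges : NodupEdges gadgetEdges := by decide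

theorem nodupEdges_gadgetEdges' : NodupEdges gadgetEdges' := by decide

theorem ncard_spanningTrees_gadget : (spanningTrees (ofList gadgetEdges)).ncard = 15360 := by
  rw [ncard_spanningTrees_ofList _ nodupEdges_gadgetEdges]
  decide +kernel

theorem ncard_spanningTrees_gadget' : (spanningTrees (ofList gadgetEdges')).ncard = 15360 := by
  rw [ncard_spanningTrees_ofList _ nodupEdges_gadgetEdges']
  decide +kernel

theorem card_neighborFinset_gadget : ∀ v : Fin 10,
    ((ofList gadgetEdges).neighborFinset v).card = if v = 0 then 2 else 4 := by
  decide +kernel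

theorem card_neighborFinset_gadget' : ∀ v : Fin 10,
    ((ofList gadgetEdges').neighborFinset v).card = if v = 0 then 2 else 4 := by
  decide +kernel

theorem ncard_neighborSet_gadget (v : Fin 10) :
    ((ofList gadgetEdges).neighborSet v).ncard = if v = 0 then 2 else 4 := by
  rw [← card_neighborFinset_gadget, ← Set.ncard_coe_finset, coe_neighborFinset]

theorem ncard_neighborSet_gadget' (v : Fin 10) :
    ((ofList gadgetEdges').neighborSet v).ncard = if v = 0 then 2 else 4 := by
  rw [← card_neighborFinset_gadget', ← Set.ncard_coe_finset, coe_neighborFinset]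

theorem ncard_eulerianOrientations_gadget :
    (eulerianOrientations (ofList gadgetEdges)).ncard = 160 := by
  -- The prescribed out-degrees are half the degrees: 1 at the root, 2 elsewhere.
  rw [ncard_eulerianOrientations_ofList _ nodupEdges_gadgetEdges (by decide)
    [1, 2, 2, 2, 2, 2, 2, 2, 2, 2] rfl fun v => by
      rw [ncard_neighborSet_gadget]; revert v; decide]
  decide +kernel

theorem ncard_eulerianOrientations_gadget' :
    (eulerianOrientations (ofList gadgetEdges')).ncard = 164 := by
  rw [ncard_eulerianOrientations_ofList _ nodupEdges_gadgetEdges' (by decide)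
    [1, 2, 2, 2, 2, 2, 2, 2, 2, 2] rfl fun v => by
      rw [ncard_neighborSet_gadget']; revert v; decide]
  decide +kernel

theorem connected_of_ncard_spanningTrees_ne_zero {V : Type*} {G : SimpleGraph V}
    (h : (spanningTrees G).ncard ≠ 0) : G.Connected := by
  obtain ⟨T, hT⟩ := Set.nonempty_of_ncard_ne_zero h
  exact hT.2.1.mono hT.1

end SimpleGraph

theorem mainTheorem10 :
    ¬ ∃ rho : ℕ → ℝ → ℝ,
      ∀ (d : ℕ), 0 < d → Even d → ∀ (τ : ℝ) (n : ℕ → ℕ) (G : ∀ i, SimpleGraph (Fin (n i))),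
        IsIncreasingRegularSeq d n G →
        Tendsto (fun i => spanningTreeEntropy (G i)) atTop (𝓝 τ) →
        Tendsto (fun i => residualEntropy (G i)) atTop (𝓝 (rho d τ)) := by
  -- The cycle raises the degree of each root from 2 to 4. Connectedness of the gadgets is read off
  -- from their nonzero tree counts.
  refine SimpleGraph.not_exists_limit_of_gadgets (d := 4) (E := SimpleGraph.ofList SimpleGraph.gadgetEdges)
    (E' := SimpleGraph.ofList SimpleGraph.gadgetEdges') (by norm_num) (by decide)
    (SimpleGraph.connected_of_ncard_spanningTrees_ne_zero (by simp [SimpleGraph.ncard_spanningTrees_gadget]))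
    (SimpleGraph.connected_of_ncard_spanningTrees_ne_zero (by simp [SimpleGraph.ncard_spanningTrees_gadget']))
    (fun v => by rw [SimpleGraph.ncard_neighborSet_gadget]; split_ifs <;> rfl)
    (fun v => by rw [SimpleGraph.ncard_neighborSet_gadget']; split_ifs <;> rfl)
    (SimpleGraph.ncard_spanningTrees_gadget.trans SimpleGraph.ncard_spanningTrees_gadget'.symm) ?_ ?_ ?_ <;>
  simp [SimpleGraph.ncard_eulerianOrientations_gadget, SimpleGraph.ncard_eulerianOrientations_gadget']
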